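/- Let $n,t,d\in\mathbb{N}$, let $\mathbf{x}=(x_1,\dots,x_n)$ and $\mathbf{y}=(y_1,\dots,y_t)$, and let $\mathbb{C}[\mathbf{x},\mathbf{y}]_d$ be the space of polynomials in $\mathbb{C}[\mathbf{x},\mathbf{y}]$ of total degree at most $d$. The space $\mathbb{C}[\mathbf{x},\mathbf{y}]_d^n$ is regarded as a complex affine space whose coordinates are the coefficients of the $n$ polynomials. For $\mathbf{f}=(f_1,\dots,f_n)\in\mathbb{Q}[\mathbf{x},\mathbf{y}]^n$, let $\mathcal{G}(\mathbf{f})$ be the reduced Gröbner basis of the ideal $\langle f_1,\dots,f_n\rangle\subset\mathbb{Q}[\mathbf{x},\mathbf{y}]$ with respect to the elimination order $\mathrm{grevlex}(\mathbf{x})\succ\mathrm{grevlex}(\mathbf{y})$: monomials are compared first by their parts in $\mathbf{x}$, with the graded reverse lexicographic order for $x_1\succ\cdots\succ x_n$, and ties are broken by their parts in $\mathbf{y}$, with the graded reverse lexicographic order for $y_1\succ\cdots\succ y_t$. For $g\in\mathbb{Q}[\mathbf{x},\mathbf{y}]$, let $\deg(g)$ be the total degree of $g$ in $(\mathbf{x},\mathbf{y})$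 and $\deg_{\mathbf{x}}(g)$ its degree in the variables $\mathbf{x}$, and let $\mathrm{lc}_{\mathbf{x}}(g)\in\mathbb{Q}[\mathbf{y}]$ be the leading coefficient, with respect to $\mathrm{grevlex}(\mathbf{x})$, of $g$ viewed as a polynomial in $\mathbf{x}$ with coefficients in $\mathbb{Q}[\mathbf{y}]$. Then there exists a non-empty Zariski open subset $\mathscr{F}$ of $\mathbb{C}[\mathbf{x},\mathbf{y}]_d^n$ such that every $\mathbf{f}\in\mathscr{F}\cap\mathbb{Q}[\mathbf{x},\mathbf{y}]^n$ satisfies: 1. (Assumption E) $\deg(g)=\deg_{\mathbf{x}}(g)$ for every $g\in\mathcal{G}(\mathbf{f})$; 2. (Assumption C) consequently, for every $g\in\mathcal{G}(\mathbf{f})$ the leading coefficient $\mathrm{lc}_{\mathbf{x}}(g)$ does not depend on $\mathbf{y}$, i.e. it is a constant in $\mathbb{Q}$. -/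

import Mathlib

/-- Exponent vectors of monomials in `X 0, …, X (k - 1)`, to be ordered by grevlex. -/
def DegRevLex (k : ℕ) : Type := Fin k →₀ ℕ

namespace DegRevLex

variable {k : ℕ}

noncomputable instance : AddCommMonoid (DegRevLex k) :=
  inferInstanceAs (AddCommMonoid (Fin k →₀ ℕ))

/-- The total degree, followed by the exponents read from the last variable to the first one, each
in the dual order of `ℕ`. Grevlex compares these data lexicographically. -/
noncomputable def key (a : Fin k →₀ ℕ) : ℕ ×ₗ Lex (Fin k → ℕᵒᵈ) :=
  toLex (a.degree, toLex fun i => OrderDual.toDual (a i.rev))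

theorem key_injective : Function.Injective (key (k := k)) := by
  intro a b h
  have h2 := congrArg (fun z => ofLex (ofLex z).2) h
  ext i
  have := congrFun h2 i.rev
  simpa [key] using this

theorem key_add (a b : Fin k →₀ ℕ) : key (a + b) = key a + key b := by
  apply ofLex.injective
  refine Prod.ext ?_ ?_
  · exact map_add Finsupp.degree a b
  · rfl

noncomputable instance : LinearOrder (DegRevLex k) :=
  LinearOrder.lift' (fun a : DegRevLex k => key a) key_injective

theorem lt_def (a b : DegRevLex k) : a < b ↔ key a < key b := Iff.rfl

theorem le_def (a b : DegRevLex k) : a ≤ b ↔ key a ≤ key b := Iff.rfl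

instance : IsOrderedAddMonoid (DegRevLex k) where
  add_le_add_left a b h c := by
    rw [le_def] at h ⊢
    have e : ∀ u v : DegRevLex k, key (u + v) = key u + key v := key_add
    rw [e, e]
    exact add_le_add_left h _

theorem mono_of_le {a b : Fin k →₀ ℕ} (h : a ≤ b) : key a ≤ key b := by
  obtain ⟨c, rfl⟩ := exists_add_of_le h
  rw [key, key, Prod.Lex.toLex_le_toLex]
  rcases Nat.eq_zero_or_pos c.degree with hc | hc
  · rw [Finsupp.degree_eq_zero_iff] at hc
    subst hc
    simp
  · left
    simp only [map_add]
    omega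

end DegRevLex

/-- The graded reverse lexicographic order with `X 0 ≻ X 1 ≻ ⋯ ≻ X (k - 1)`. -/
noncomputable def grevlex (k : ℕ) : MonomialOrder (Fin k) where
  syn := DegRevLex k
  toSyn := { toEquiv := Equiv.refl (Fin k →₀ ℕ), map_add' := fun _ _ => rfl }
  toSyn_monotone := fun _ _ h => DegRevLex.mono_of_le h
  wellFoundedLT_syn :=
    haveI : WellQuasiOrderedLE (DegRevLex k) :=
      Monotone.wellQuasiOrderedLE_of_wellQuasiOrderedLE_of_surjective
        (f := fun a : Fin k →₀ ℕ => (a : DegRevLex k))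
        (fun _ _ h => DegRevLex.mono_of_le h) (fun a => ⟨a, rfl⟩)
    inferInstance

/-- Grevlex spelled out: compare total degrees first; in case of a tie, the larger monomial is the
one with the smaller exponent at the last variable where the exponents differ. -/
theorem grevlex_lt_iff {k : ℕ} (a b : Fin k →₀ ℕ) :
    (grevlex k).toSyn a < (grevlex k).toSyn b ↔
      a.degree < b.degree ∨
        a.degree = b.degree ∧ ∃ i, (∀ j, i < j → a j = b j) ∧ b i < a i := by
  change DegRevLex.key a < DegRevLex.key b ↔ _
  rw [DegRevLex.key, DegRevLex.key, Prod.Lex.toLex_lt_toLex]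
  refine or_congr Iff.rfl (and_congr Iff.rfl ?_)
  constructor
  · rintro ⟨i, h1, h2⟩
    refine ⟨i.rev, fun j hj => ?_, h2⟩
    have := h1 j.rev (by simpa [Fin.lt_def, Fin.val_rev] using (by
      have := j.isLt; have := i.isLt
      simp only [Fin.lt_def, Fin.val_rev] at hj
      omega : k - (j.val + 1) < i.val))
    simpa using this
  · rintro ⟨i, h1, h2⟩
    refine ⟨i.rev, fun j hj => ?_, ?_⟩
    · have := h1 j.rev (by
        have := j.isLt; have := i.isLt
        simp only [Fin.lt_def, Fin.val_rev] at hj ⊢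
        omega)
      simpa using this
    · change OrderDual.toDual (a i.rev.rev) < OrderDual.toDual (b i.rev.rev)
      simpa using h2

/-- The block (elimination) order `m₁ ≻ m₂`: compare the parts in the first block of variables
by `m₁`, and break ties by comparing the parts in the second block by `m₂`. -/
noncomputable def MonomialOrder.block {σ τ : Type*} (m₁ : MonomialOrder σ) (m₂ : MonomialOrder τ) :
    MonomialOrder (σ ⊕ τ) where
  syn := m₁.syn ×ₗ m₂.syn
  toSyn :=
    { toFun := fun a => toLex
        (m₁.toSyn (Finsupp.sumFinsuppAddEquivProdFinsupp a).1,
          m₂.toSyn (Finsupp.sumFinsuppAddEquivProdFinsupp a).2)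
      invFun := fun z => Finsupp.sumFinsuppAddEquivProdFinsupp.symm
        (m₁.toSyn.symm (ofLex z).1, m₂.toSyn.symm (ofLex z).2)
      left_inv := fun a => by simp
      right_inv := fun z => by simp
      map_add' := fun a b => by
        rw [map_add, Prod.fst_add, Prod.snd_add, map_add, map_add]
        rfl }
  toSyn_monotone := fun a b h => by
    have h1 : (Finsupp.sumFinsuppAddEquivProdFinsupp a).1 ≤
        (Finsupp.sumFinsuppAddEquivProdFinsupp b).1 := fun i => h (Sum.inl i)
    have h2 : (Finsupp.sumFinsuppAddEquivProdFinsupp a).2 ≤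
        (Finsupp.sumFinsuppAddEquivProdFinsupp b).2 := fun i => h (Sum.inr i)
    exact Prod.Lex.toLex_mono ⟨m₁.toSyn_monotone h1, m₂.toSyn_monotone h2⟩

/-- The order `grevlex(x) ≻ grevlex(y)`; `Sum.inl i` indexes `x` and `Sum.inr j` indexes `y`. -/
noncomputable def elimOrder (n t : ℕ) : MonomialOrder (Fin n ⊕ Fin t) :=
  (grevlex n).block (grevlex t)

section Groebner

variable {σ K : Type*} [Field K]

/-- The leading monomials of the nonzero elements of `S`. -/
def MonomialOrder.leadingMonomials (m : MonomialOrder σ) (S : Set (MvPolynomial σ K)) :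
    Set (MvPolynomial σ K) :=
  (fun e => MvPolynomial.monomial e (1 : K)) '' {e | ∃ p ∈ S, p ≠ 0 ∧ m.degree p = e}

/-- `G` generates `I`, and its leading monomials generate the initial ideal of `I`. -/
structure IsGroebnerBasis (m : MonomialOrder σ) (I : Ideal (MvPolynomial σ K))
    (G : Set (MvPolynomial σ K)) : Prop where
  span_eq : Ideal.span G = I
  initial_eq : Ideal.span (m.leadingMonomials G) =
    Ideal.span (m.leadingMonomials (I : Set (MvPolynomial σ K)))

/-- A Gröbner basis is reduced if its elements are monic and no term of an element is divisible by
the leading monomial of another element. -/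
structure IsReducedGroebnerBasis (m : MonomialOrder σ) (I : Ideal (MvPolynomial σ K))
    (G : Finset (MvPolynomial σ K)) : Prop where
  isGroebner : IsGroebnerBasis m I (G : Set (MvPolynomial σ K))
  monic : ∀ g ∈ G, m.Monic g
  reduced : ∀ g ∈ G, ∀ g' ∈ G, g' ≠ g → ∀ e ∈ g.support, ¬ m.degree g' ≤ e

theorem degree_set_up {m : MonomialOrder σ} {I : Ideal (MvPolynomial σ K)} {a b : σ →₀ ℕ}
    (h : ∃ p ∈ I, p ≠ 0 ∧ m.degree p = a) (hab : a ≤ b) :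
    ∃ p ∈ I, p ≠ 0 ∧ m.degree p = b := by
  classical
  obtain ⟨p, hp, hp0, rfl⟩ := h
  obtain ⟨c, rfl⟩ := exists_add_of_le hab
  have hc : (MvPolynomial.monomial c (1 : K)) ≠ 0 := by simp
  refine ⟨MvPolynomial.monomial c 1 * p, I.mul_mem_left _ hp, mul_ne_zero hc hp0, ?_⟩
  rw [m.degree_mul hc hp0, m.degree_monomial]
  simp [add_comm]

/-- Each exponent of a leading monomial of `I` is that of a monic element of `I` none of whose other
terms is a leading monomial of `I`. -/
theorem exists_monic_of_minimal (m : MonomialOrder σ) (I : Ideal (MvPolynomial σ K))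
    {e : σ →₀ ℕ} (he : ∃ p ∈ I, p ≠ 0 ∧ m.degree p = e) :
    ∃ g ∈ I, m.Monic g ∧ m.degree g = e ∧
      ∀ c ∈ g.support, (∃ p ∈ I, p ≠ 0 ∧ m.degree p = c) → c = e := by
  classical
  have hB : ∀ b ∈ {p : MvPolynomial σ K | p ∈ I ∧ p ≠ 0}, IsUnit (m.leadingCoeff b) :=
    fun b hb => isUnit_iff_ne_zero.2 (m.leadingCoeff_ne_zero_iff.2 hb.2)
  obtain ⟨q, r, hqr, -, hr⟩ := m.div_set hB (MvPolynomial.monomial e (1 : K))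
  have hrD : ∀ c ∈ r.support, ¬ ∃ p ∈ I, p ≠ 0 ∧ m.degree p = c := by
    rintro c hc ⟨p, hp, hp0, hpc⟩
    exact hr c hc p ⟨hp, hp0⟩ hpc.le
  have hmem : MvPolynomial.monomial e (1 : K) - r ∈ I := by
    rw [hqr, add_sub_cancel_right, Finsupp.linearCombination_apply]
    exact I.sum_mem fun b _ => I.mul_mem_left _ b.2.1
  have hre : r.coeff e = 0 := by
    by_contra h
    exact hrD e (MvPolynomial.mem_support_iff.2 h) he
  have hcoeff : (MvPolynomial.monomial e (1 : K) - r).coeff e = 1 := by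
    simp [hre]
  have hne : MvPolynomial.monomial e (1 : K) - r ≠ 0 := by
    intro h
    rw [h] at hcoeff
    simp at hcoeff
  have hsupp : ∀ c ∈ (MvPolynomial.monomial e (1 : K) - r).support,
      (∃ p ∈ I, p ≠ 0 ∧ m.degree p = c) → c = e := by
    intro c hc hcD
    by_contra hce
    refine hrD c ?_ hcD
    rw [MvPolynomial.mem_support_iff] at hc ⊢
    rw [MvPolynomial.coeff_sub, MvPolynomial.coeff_monomial, if_neg (Ne.symm hce)] at hc
    simpa using hc
  have hdeg : m.degree (MvPolynomial.monomial e (1 : K) - r) = e :=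
    hsupp _ (m.degree_mem_support hne) ⟨_, hmem, hne, rfl⟩
  refine ⟨_, hmem, ?_, hdeg, hsupp⟩
  rw [MonomialOrder.Monic, MonomialOrder.leadingCoeff, hdeg, hcoeff]

theorem IsReducedGroebnerBasis.exists_le {m : MonomialOrder σ} {I : Ideal (MvPolynomial σ K)}
    {G : Finset (MvPolynomial σ K)} (h : IsReducedGroebnerBasis m I G) {e : σ →₀ ℕ}
    (he : ∃ p ∈ I, p ≠ 0 ∧ m.degree p = e) : ∃ g ∈ G, m.degree g ≤ e := by
  classical
  have : MvPolynomial.monomial e (1 : K) ∈ Ideal.span (m.leadingMonomials (G : Set _)) := by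
    rw [h.isGroebner.initial_eq]
    exact Ideal.subset_span ⟨e, he, rfl⟩
  rw [MonomialOrder.leadingMonomials, MvPolynomial.mem_ideal_span_monomial_image] at this
  obtain ⟨_, ⟨g, hg, -, rfl⟩, hle⟩ := this e (by simp [MvPolynomial.mem_support_iff])
  exact ⟨g, hg, hle⟩

theorem IsReducedGroebnerBasis.mem_iff {m : MonomialOrder σ} {I : Ideal (MvPolynomial σ K)}
    {G : Finset (MvPolynomial σ K)} (h : IsReducedGroebnerBasis m I G) (g : MvPolynomial σ K) :
    g ∈ G ↔ g ∈ I ∧ m.Monic g ∧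
      Minimal (fun e => ∃ p ∈ I, p ≠ 0 ∧ m.degree p = e) (m.degree g) ∧
      ∀ c ∈ g.support, (∃ p ∈ I, p ≠ 0 ∧ m.degree p = c) → c = m.degree g := by
  classical
  have hI : ∀ g ∈ G, g ∈ I := fun g hg => by
    rw [← h.isGroebner.span_eq]
    exact Ideal.subset_span hg
  have key : ∀ g ∈ G, ∀ c ∈ g.support, (∃ p ∈ I, p ≠ 0 ∧ m.degree p = c) → m.degree g ≤ c := by
    intro g hg c hc hcD
    obtain ⟨g', hg', hle⟩ := h.exists_le hcD
    by_cases hgg : g' = g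
    · exact hgg ▸ hle
    · exact absurd hle (h.reduced g hg g' hg' hgg c hc)
  have hmin : ∀ g ∈ G, Minimal (fun e => ∃ p ∈ I, p ≠ 0 ∧ m.degree p = e) (m.degree g) := by
    intro g hg
    have hg0 := (h.monic g hg).ne_zero
    refine ⟨⟨g, hI g hg, hg0, rfl⟩, fun e he hle => ?_⟩
    obtain ⟨g', hg', hle'⟩ := h.exists_le he
    by_cases hgg : g' = g
    · exact hgg ▸ hle'
    · exact absurd (hle'.trans hle)
        (h.reduced g hg g' hg' hgg _ (m.degree_mem_support hg0))
  have hcan : ∀ g ∈ G, ∀ c ∈ g.support, (∃ p ∈ I, p ≠ 0 ∧ m.degree p = c) →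
      c = m.degree g := by
    intro g hg c hc hcD
    apply m.toSyn.injective
    exact le_antisymm (m.le_degree hc) (m.toSyn_monotone (key g hg c hc hcD))
  refine ⟨fun hg => ⟨hI g hg, h.monic g hg, hmin g hg, hcan g hg⟩, ?_⟩
  rintro ⟨hgI, hgm, hgmin, hgc⟩
  obtain ⟨g', hg', hle⟩ := h.exists_le hgmin.prop
  have hdeg : m.degree g' = m.degree g := le_antisymm hle (hgmin.2 (hmin g' hg').prop hle)
  suffices g = g' by rwa [this]
  by_contra hne
  have hsub : g - g' ≠ 0 := sub_ne_zero.2 hne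
  have hs := m.degree_mem_support hsub
  have hD : ∃ p ∈ I, p ≠ 0 ∧ m.degree p = m.degree (g - g') :=
    ⟨_, I.sub_mem hgI (hI g' hg'), hsub, rfl⟩
  have heq : m.degree (g - g') = m.degree g := by
    rcases Finset.mem_union.1 (MvPolynomial.support_sub σ g g' hs) with h1 | h1
    · exact hgc _ h1 hD
    · exact (hcan g' hg' _ h1 hD).trans hdeg
  rw [MvPolynomial.mem_support_iff, heq, MvPolynomial.coeff_sub] at hs
  have e1 : g.coeff (m.degree g) = 1 := hgm
  have e2 : g'.coeff (m.degree g) = 1 := hdeg ▸ h.monic g' hg'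
  rw [e1, e2, sub_self] at hs
  exact hs rfl

/-- With respect to a fixed monomial order, every ideal of a polynomial ring in finitely many
variables over a field has exactly one reduced Gröbner basis. -/
theorem existsUnique_reducedGroebnerBasis [Finite σ] (m : MonomialOrder σ)
    (I : Ideal (MvPolynomial σ K)) : ∃! G, IsReducedGroebnerBasis m I G := by
  classical
  let D : (σ →₀ ℕ) → Prop := fun e => ∃ p ∈ I, p ≠ 0 ∧ m.degree p = e
  have hfin : {e | Minimal D e}.Finite :=
    WellQuasiOrderedLE.finite_of_isAntichain (setOfPred_minimal_antichain D)
  have hex : ∀ e, ∃ g, D e → g ∈ I ∧ m.Monic g ∧ m.degree g = e ∧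
      ∀ c ∈ g.support, D c → c = e := by
    intro e
    by_cases he : D e
    · obtain ⟨g, h1, h2⟩ := exists_monic_of_minimal m I he
      exact ⟨g, fun _ => ⟨h1, h2⟩⟩
    · exact ⟨0, fun h => absurd h he⟩
  choose b hb using hex
  let G : Finset (MvPolynomial σ K) := hfin.toFinset.image b
  have hG : ∀ g, g ∈ G ↔ ∃ e, Minimal D e ∧ b e = g := by
    intro g
    simp [G]
  have hGI : ∀ g ∈ G, g ∈ I := by
    intro g hg
    obtain ⟨e, he, rfl⟩ := (hG g).1 hg
    exact (hb e he.prop).1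
  have hGm : ∀ g ∈ G, m.Monic g := by
    intro g hg
    obtain ⟨e, he, rfl⟩ := (hG g).1 hg
    exact (hb e he.prop).2.1
  have hle : ∀ e, D e → ∃ g ∈ G, m.degree g ≤ e := by
    intro e he
    obtain ⟨e', hle, hmin⟩ := exists_minimal_le_of_wellFoundedLT D e he
    exact ⟨b e', (hG _).2 ⟨e', hmin, rfl⟩, (hb e' hmin.prop).2.2.1.le.trans hle⟩
  have hex : IsReducedGroebnerBasis m I G := by
    refine ⟨⟨?_, ?_⟩, hGm, ?_⟩
    · refine le_antisymm (Ideal.span_le.2 hGI) fun p hp => ?_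
      have hB : ∀ g ∈ (G : Set (MvPolynomial σ K)), IsUnit (m.leadingCoeff g) := fun g hg => by
        rw [(hGm g hg).leadingCoeff_eq_one]
        exact isUnit_one
      obtain ⟨q, r, hqr, -, hr⟩ := m.div_set hB p
      have hlin : Finsupp.linearCombination (MvPolynomial σ K)
          (fun g : (G : Set (MvPolynomial σ K)) => (g : MvPolynomial σ K)) q ∈
          Ideal.span (G : Set (MvPolynomial σ K)) := by
        rw [Finsupp.linearCombination_apply]
        exact Ideal.sum_mem _ fun g _ => Ideal.mul_mem_left _ _ (Ideal.subset_span g.2)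
      have hrI : r ∈ I := by
        have : r = p - Finsupp.linearCombination (MvPolynomial σ K)
            (fun g : (G : Set (MvPolynomial σ K)) => (g : MvPolynomial σ K)) q := by
          rw [hqr, add_sub_cancel_left]
        rw [this]
        exact I.sub_mem hp (Ideal.span_le.2 hGI hlin)
      have hr0 : r = 0 := by
        by_contra hr0
        obtain ⟨g, hg, hgr⟩ := hle _ ⟨r, hrI, hr0, rfl⟩
        exact hr _ (m.degree_mem_support hr0) g hg hgr
      rw [hqr, hr0, add_zero]
      exact hlin
    · refine le_antisymm (Ideal.span_mono ?_) (Ideal.span_le.2 ?_)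
      · exact Set.image_mono fun e ⟨g, hg, h0, he⟩ => ⟨g, hGI g hg, h0, he⟩
      · rintro _ ⟨e, he, rfl⟩
        obtain ⟨g, hg, hge⟩ := hle e he
        rw [SetLike.mem_coe, MonomialOrder.leadingMonomials,
          MvPolynomial.mem_ideal_span_monomial_image]
        intro c hc
        rw [MvPolynomial.mem_support_iff, MvPolynomial.coeff_monomial] at hc
        have hce : e = c := by
          by_contra h
          exact hc (if_neg h)
        exact ⟨m.degree g, ⟨g, hg, (hGm g hg).ne_zero, rfl⟩, hce ▸ hge⟩
    · intro g hg g' hg' hne c hc hle'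
      obtain ⟨e, he, rfl⟩ := (hG g).1 hg
      obtain ⟨e', he', rfl⟩ := (hG g').1 hg'
      have hd' := (hb e' he'.prop).2.2.1
      rw [hd'] at hle'
      have hce := (hb e he.prop).2.2.2 c hc (degree_set_up he'.prop hle')
      subst hce
      exact hne (congrArg b (le_antisymm hle' (he.2 he'.prop hle')))
  refine ⟨G, hex, fun G' hG' => ?_⟩
  ext g
  rw [hG'.mem_iff, hex.mem_iff]

/-- The reduced Gröbner basis of `I` with respect to `m`. -/
noncomputable def reducedGroebnerBasis [Finite σ] (m : MonomialOrder σ)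
    (I : Ideal (MvPolynomial σ K)) : Finset (MvPolynomial σ K) :=
  (existsUnique_reducedGroebnerBasis m I).choose

theorem isReducedGroebnerBasis_reducedGroebnerBasis [Finite σ] (m : MonomialOrder σ)
    (I : Ideal (MvPolynomial σ K)) :
    IsReducedGroebnerBasis m I (reducedGroebnerBasis m I) :=
  (existsUnique_reducedGroebnerBasis m I).choose_spec.1

end Groebner

/-- The reduced Gröbner basis of `⟨f₁, …, fₙ⟩ ⊆ ℚ[x, y]` for `grevlex(x) ≻ grevlex(y)`. -/
noncomputable def groebnerOfSystem {n t : ℕ} (f : Fin n → MvPolynomial (Fin n ⊕ Fin t) ℚ) :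
    Finset (MvPolynomial (Fin n ⊕ Fin t) ℚ) :=
  reducedGroebnerBasis (elimOrder n t) (Ideal.span (Set.range f))

/-- `p ∈ ℚ[x, y]` viewed as a polynomial in the variables `x` with coefficients in `ℚ[y]`. -/
noncomputable def asPolyInX {n t : ℕ} (p : MvPolynomial (Fin n ⊕ Fin t) ℚ) :
    MvPolynomial (Fin n) (MvPolynomial (Fin t) ℚ) :=
  MvPolynomial.sumAlgEquiv ℚ (Fin n) (Fin t) p

/-- The partial degree `deg_x(p)`. -/
noncomputable def degX {n t : ℕ} (p : MvPolynomial (Fin n ⊕ Fin t) ℚ) : ℕ :=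
  (asPolyInX p).totalDegree

/-- The leading coefficient `lc_x(p) ∈ ℚ[y]` of `p` with respect to `grevlex(x)`. -/
noncomputable def lcX {n t : ℕ} (p : MvPolynomial (Fin n ⊕ Fin t) ℚ) : MvPolynomial (Fin t) ℚ :=
  (grevlex n).leadingCoeff (asPolyInX p)

/-- Every element `g` of the reduced Gröbner basis satisfies `deg(g) = deg_x(g)`. -/
def AssumptionE {n t : ℕ} (f : Fin n → MvPolynomial (Fin n ⊕ Fin t) ℚ) : Prop :=
  ∀ g ∈ groebnerOfSystem f, g.totalDegree = degX g

/-- For every element `g` of the reduced Gröbner basis, `lc_x(g)` is a constant. -/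
def AssumptionC {n t : ℕ} (f : Fin n → MvPolynomial (Fin n ⊕ Fin t) ℚ) : Prop :=
  ∀ g ∈ groebnerOfSystem f, ∃ c : ℚ, lcX g = MvPolynomial.C c

/-- The affine space `ℂ[x, y]_d ^ n` of systems of `n` polynomials of total degree at most `d`. -/
abbrev SystemSpace (n t d : ℕ) : Type :=
  Fin n → MvPolynomial.restrictTotalDegree (Fin n ⊕ Fin t) ℂ d

/-- The coordinates of a system: the coefficients of its members at the monomials of degree at
most `d`. -/
noncomputable def SystemSpace.coords {n t d : ℕ} (F : SystemSpace n t d) :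
    Fin n × {e : (Fin n ⊕ Fin t) →₀ ℕ // e.degree ≤ d} → ℂ :=
  fun z => (F z.1 : MvPolynomial (Fin n ⊕ Fin t) ℂ).coeff z.2

/-- Zariski open subsets of the space of systems: those defined by the non-vanishing of at least
one member of some set of polynomials in the coordinates. -/
def SystemSpace.IsZariskiOpen {n t d : ℕ} (U : Set (SystemSpace n t d)) : Prop :=
  ∃ S : Set (MvPolynomial (Fin n × {e : (Fin n ⊕ Fin t) →₀ ℕ // e.degree ≤ d}) ℂ),
    U = {F | ∃ P ∈ S, MvPolynomial.eval F.coords P ≠ 0}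

/-!
Throughout, a monomial in `(x, y)` is written `x ^ a * y ^ c`, and for `d ≥ 1` quotients and
remainders of exponent vectors by `d` are taken coordinatewise.

Only the monomials `x ^ a` with `|a| = d` have degree `d` in `x` within a polynomial of total degree
at most `d`, so the part `fᵢ*` of `fᵢ` of degree `d` in `x` has constant coefficients. For generic
`f`, the products `(f*) ^ (a / d) * x ^ (a % d)` with `|a| = k` span the homogeneous polynomials in
`x` of degree `k`, for every `k`. This holds for `fᵢ = xᵢ ^ d`, where the product is `x ^ a`. It
amounts to the non-vanishing of determinants (`adicDiscriminant`), and only the finitely many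
`k ≤ n * (d - 1) + 1` matter: in the last of these degrees every exponent vector has a coordinate
`≥ d`, so all monomials lie in `⟨f*⟩`, and larger degrees follow by induction (`lowDegree_le_map`).

Consequently the linear map `Φ : x ^ a * y ^ c ↦ f ^ (a / d) * x ^ (a % d) * y ^ c` (`adicMap`)
maps each finite-dimensional space `{deg_x < k, deg ≤ D}` onto itself, so it is bijective and
preserves the degree in `x`. Since `fᵢ * Φ(q) = Φ(xᵢ ^ d * q)`, the ideal `⟨f⟩` is the image under
`Φ` of `⟨x₁ ^ d, …, xₙ ^ d⟩`. This replaces the usual arguments with regular sequences and Koszul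
syzygies.

Let now `x ^ a * y ^ b` be the leading monomial of `p = Φ(q) ∈ ⟨f⟩`. The terms of `q` of degree
`|a|` in `x` with `y`-part `y ^ b`, divided by `y ^ b`, have an image `h ∈ ⟨f⟩` under `Φ` of total
degree at most `|a|` and with leading monomial `x ^ a` (`exists_mem_span_totalDegree_le`). So the
minimal leading monomials of `⟨f⟩` involve only `x`, and reducing by elements such as `h` never
raises the total degree. Hence an element `g` of the reduced Gröbner basis with leading monomial
`x ^ a` has total degree `|a| = deg_x g` (`assumptionE_of_exists`), and the coefficient of `x ^ a`
in `g` has no room for `y` (`exists_lcX_eq_C`). For `d = 0` a generic `fᵢ` is a nonzero constant.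
-/

/-! ### Degrees and the elimination order -/

namespace ElimOrder

variable {n t : ℕ}

/-- The `x`-part of an exponent vector: the exponents of the `y`-variables are replaced by `0`. -/
noncomputable def xPart (e : Fin n ⊕ Fin t →₀ ℕ) : Fin n ⊕ Fin t →₀ ℕ :=
  e.filter fun s => s.isLeft = true

/-- The `y`-part of an exponent vector: the exponents of the `x`-variables are replaced by `0`. -/
noncomputable def yPart (e : Fin n ⊕ Fin t →₀ ℕ) : Fin n ⊕ Fin t →₀ ℕ :=
  e.filter fun s => ¬ s.isLeft = true

/-- The degree in `x` of the monomial with a given exponent vector. -/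
noncomputable def xDeg (e : Fin n ⊕ Fin t →₀ ℕ) : ℕ := (xPart e).degree

theorem xPart_add_yPart (e : Fin n ⊕ Fin t →₀ ℕ) : xPart e + yPart e = e :=
  Finsupp.filter_add_filter_not _ _

@[simp] theorem xPart_inl (e : Fin n ⊕ Fin t →₀ ℕ) (i : Fin n) :
    xPart e (Sum.inl i) = e (Sum.inl i) :=
  Finsupp.filter_apply_pos _ _ rfl

@[simp] theorem xPart_inr (e : Fin n ⊕ Fin t →₀ ℕ) (j : Fin t) : xPart e (Sum.inr j) = 0 := by
  simp [xPart]

@[simp] theorem yPart_inl (e : Fin n ⊕ Fin t →₀ ℕ) (i : Fin n) : yPart e (Sum.inl i) = 0 := by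
  simp [yPart]

@[simp] theorem yPart_inr (e : Fin n ⊕ Fin t →₀ ℕ) (j : Fin t) :
    yPart e (Sum.inr j) = e (Sum.inr j) :=
  Finsupp.filter_apply_pos _ _ (by simp)

@[simp] theorem xPart_add (a b : Fin n ⊕ Fin t →₀ ℕ) : xPart (a + b) = xPart a + xPart b :=
  Finsupp.filter_add

@[simp] theorem yPart_add (a b : Fin n ⊕ Fin t →₀ ℕ) : yPart (a + b) = yPart a + yPart b :=
  Finsupp.filter_add

@[simp] theorem xPart_xPart (e : Fin n ⊕ Fin t →₀ ℕ) : xPart (xPart e) = xPart e := by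
  ext (i | j) <;> simp

@[simp] theorem yPart_xPart (e : Fin n ⊕ Fin t →₀ ℕ) : yPart (xPart e) = 0 := by
  ext (i | j) <;> simp

@[simp] theorem xPart_yPart (e : Fin n ⊕ Fin t →₀ ℕ) : xPart (yPart e) = 0 := by
  ext (i | j) <;> simp

@[simp] theorem yPart_yPart (e : Fin n ⊕ Fin t →₀ ℕ) : yPart (yPart e) = yPart e := by
  ext (i | j) <;> simp

@[simp] theorem xDeg_add (a b : Fin n ⊕ Fin t →₀ ℕ) : xDeg (a + b) = xDeg a + xDeg b := by
  simp [xDeg]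

theorem degree_eq (e : Fin n ⊕ Fin t →₀ ℕ) : e.degree = xDeg e + (yPart e).degree := by
  rw [xDeg, ← map_add, xPart_add_yPart]

theorem xDeg_le_degree (e : Fin n ⊕ Fin t →₀ ℕ) : xDeg e ≤ e.degree := by
  rw [degree_eq]
  omega

theorem xDeg_eq_degree {e : Fin n ⊕ Fin t →₀ ℕ} (h : yPart e = 0) : xDeg e = e.degree := by
  rw [degree_eq, h]
  simp

theorem yPart_eq_zero_of_degree_le {e : Fin n ⊕ Fin t →₀ ℕ} (h : e.degree ≤ xDeg e) :
    yPart e = 0 := by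
  rw [degree_eq] at h
  exact (Finsupp.degree_eq_zero_iff _).1 (by omega)

theorem xDeg_eq_sum (e : Fin n ⊕ Fin t →₀ ℕ) : xDeg e = ∑ i, e (Sum.inl i) := by
  rw [xDeg, Finsupp.degree_eq_sum, Fintype.sum_sum_type]
  simp

theorem lt_of_xDeg_lt {a b : Fin n ⊕ Fin t →₀ ℕ} (h : xDeg a < xDeg b) :
    (elimOrder n t).toSyn a < (elimOrder n t).toSyn b := by
  have key : ∀ e : Fin n ⊕ Fin t →₀ ℕ,
      (Finsupp.sumFinsuppAddEquivProdFinsupp e).1.degree = xDeg e := by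
    intro e
    rw [xDeg_eq_sum, Finsupp.degree_eq_sum]
    rfl
  refine Prod.Lex.toLex_lt_toLex.2 (Or.inl ?_)
  refine (grevlex_lt_iff _ _).2 (Or.inl ?_)
  rw [key, key]
  exact h

theorem xDeg_le_of_le {a b : Fin n ⊕ Fin t →₀ ℕ}
    (h : (elimOrder n t).toSyn a ≤ (elimOrder n t).toSyn b) : xDeg a ≤ xDeg b := by
  by_contra hlt
  exact absurd h (not_le.2 (lt_of_xDeg_lt (not_le.1 hlt)))

end ElimOrder

open ElimOrder

/-! ### Gröbner bases and degrees -/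

theorem coeff_coeff_asPolyInX {n t : ℕ} (p : MvPolynomial (Fin n ⊕ Fin t) ℚ)
    (a : Fin n →₀ ℕ) (c : Fin t →₀ ℕ) :
    ((asPolyInX p).coeff a).coeff c = p.coeff (Finsupp.sumElim a c) := by
  classical
  induction p using MvPolynomial.induction_on' with
  | monomial e r =>
    have h : asPolyInX (MvPolynomial.monomial e r) =
        MvPolynomial.monomial (Finsupp.sumFinsuppAddEquivProdFinsupp e).1
          (MvPolynomial.monomial (Finsupp.sumFinsuppAddEquivProdFinsupp e).2 r) := by
      simp [asPolyInX, MvPolynomial.sumAlgEquiv, MvPolynomial.monomial]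
    have he : e = Finsupp.sumElim a c ↔ (Finsupp.sumFinsuppAddEquivProdFinsupp e).1 = a ∧
        (Finsupp.sumFinsuppAddEquivProdFinsupp e).2 = c := by
      rw [← Prod.mk.injEq, Prod.mk.eta]
      exact (Finsupp.sumFinsuppAddEquivProdFinsupp.eq_symm_apply (y := e) (x := (a, c)))
    rw [h, MvPolynomial.coeff_monomial, MvPolynomial.coeff_monomial]
    by_cases h1 : (Finsupp.sumFinsuppAddEquivProdFinsupp e).1 = a
    · simp only [he, h1, if_true, true_and, MvPolynomial.coeff_monomial]
    · simp only [he, h1, if_false, false_and, MvPolynomial.coeff_zero]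
  | add p q hp hq =>
    rw [asPolyInX, map_add, MvPolynomial.coeff_add, MvPolynomial.coeff_add, MvPolynomial.coeff_add,
      ← hp, ← hq]
    rfl

/-- Suppose that below each leading monomial of `I` there is the leading monomial of an element of
`I` whose total degree is the degree of its leading monomial. Reduction by such elements does not
raise the total degree, so the total degree of an element of `I` is controlled by those of its terms
that are leading monomials of `I`. -/
theorem totalDegree_le_of_mem_of_support {σ K : Type*} [Field K] (m : MonomialOrder σ)
    (I : Ideal (MvPolynomial σ K))
    (H : ∀ p ∈ I, p ≠ 0 → ∃ h ∈ I, h ≠ 0 ∧ m.degree h ≤ m.degree p ∧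
      h.totalDegree ≤ (m.degree h).degree) {D : ℕ} (p : MvPolynomial σ K) (hp : p ∈ I)
    (hD : ∀ c ∈ p.support, (∃ q ∈ I, q ≠ 0 ∧ m.degree q = c) → c.degree ≤ D) :
    p.totalDegree ≤ D := by
  classical
  induction hs : m.toSyn (m.degree p) using WellFoundedLT.induction generalizing p with
  | ind s ih =>
  by_cases h0 : m.degree p = 0
  · rw [m.degree_eq_zero_iff_totalDegree_eq_zero.1 h0]
    exact Nat.zero_le _
  have hp0 : p ≠ 0 := m.ne_zero_of_degree_ne_zero h0
  obtain ⟨h, hI, hh0, hle, hdeg⟩ := H p hp hp0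
  have hu : IsUnit (m.leadingCoeff h) := isUnit_iff_ne_zero.2 (m.leadingCoeff_ne_zero_iff.2 hh0)
  have hlt := m.degree_reduce_lt hu hle h0
  set u := MvPolynomial.monomial (m.degree p - m.degree h) (hu.unit⁻¹ * m.leadingCoeff p) * h
    with hu_def
  have hr : m.reduce hu p = p - u := rfl
  have huI : u ∈ I := I.mul_mem_left _ hI
  have hpD : (m.degree p).degree ≤ D :=
    hD _ (m.degree_mem_support hp0) ⟨p, hp, hp0, rfl⟩
  have huD : u.totalDegree ≤ D := by
    refine (MvPolynomial.totalDegree_mul _ _).trans ?_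
    have h1 := MvPolynomial.totalDegree_monomial_le (m.degree p - m.degree h)
      (hu.unit⁻¹ * m.leadingCoeff p)
    have h2 : (m.degree p - m.degree h).degree + (m.degree h).degree = (m.degree p).degree := by
      rw [← map_add, tsub_add_cancel_of_le hle]
    change _ ≤ (m.degree p - m.degree h).degree at h1
    omega
  rw [hr] at hlt
  have hsub : (p - u).totalDegree ≤ D := by
    refine ih _ (hs ▸ hlt) (p - u) (I.sub_mem hp huI) ?_ rfl
    intro c hc hcI
    rcases Finset.mem_union.1 (MvPolynomial.support_sub σ p u hc) with h1 | h1
    · exact hD c h1 hcI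
    · exact (MvPolynomial.le_totalDegree h1).trans huD
  rw [← sub_add_cancel p u]
  exact (MvPolynomial.totalDegree_add _ _).trans (max_le hsub huD)


theorem ElimOrder.xDeg_sumElim {n t : ℕ} (a : Fin n →₀ ℕ) (c : Fin t →₀ ℕ) :
    xDeg (Finsupp.sumElim a c) = a.degree := by
  rw [xDeg_eq_sum, Finsupp.degree_eq_sum]
  simp

theorem ElimOrder.exists_sumElim_eq {n t : ℕ} (e : Fin n ⊕ Fin t →₀ ℕ) :
    ∃ (a : Fin n →₀ ℕ) (c : Fin t →₀ ℕ), Finsupp.sumElim a c = e :=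
  ⟨_, _, Finsupp.sumFinsuppAddEquivProdFinsupp.symm_apply_apply e⟩

theorem ElimOrder.degree_sumElim {n t : ℕ} (a : Fin n →₀ ℕ) (c : Fin t →₀ ℕ) :
    (Finsupp.sumElim a c).degree = a.degree + c.degree := by
  rw [Finsupp.degree_eq_sum, Finsupp.degree_eq_sum, Finsupp.degree_eq_sum, Fintype.sum_sum_type]
  simp

theorem xDeg_le_degX {n t : ℕ} {p : MvPolynomial (Fin n ⊕ Fin t) ℚ} {e : Fin n ⊕ Fin t →₀ ℕ}
    (he : e ∈ p.support) : xDeg e ≤ degX p := by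
  obtain ⟨a, c, rfl⟩ := exists_sumElim_eq e
  rw [xDeg_sumElim]
  refine MvPolynomial.le_totalDegree (s := a) ?_
  rw [MvPolynomial.mem_support_iff] at he ⊢
  intro h
  rw [← coeff_coeff_asPolyInX, h] at he
  exact he (MvPolynomial.coeff_zero c)

theorem degX_le_totalDegree {n t : ℕ} (p : MvPolynomial (Fin n ⊕ Fin t) ℚ) :
    degX p ≤ p.totalDegree := by
  refine Finset.sup_le fun a ha => ?_
  obtain ⟨c, hc⟩ := MvPolynomial.ne_zero_iff.1 (MvPolynomial.mem_support_iff.1 ha)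
  rw [coeff_coeff_asPolyInX] at hc
  have h := MvPolynomial.le_totalDegree (MvPolynomial.mem_support_iff.2 hc)
  change (Finsupp.sumElim a c).degree ≤ _ at h
  rw [degree_sumElim] at h
  exact (Nat.le_add_right _ _).trans h

/-- As grevlex is a graded order, the total degree of a polynomial is the total degree of its
leading monomial. -/
theorem totalDegree_le_degree_grevlex {n : ℕ} {R : Type*} [CommSemiring R]
    (p : MvPolynomial (Fin n) R) : p.totalDegree ≤ ((grevlex n).degree p).degree := by
  refine Finset.sup_le fun a ha => ?_
  change a.degree ≤ _
  by_contra h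
  exact absurd ((grevlex n).le_degree ha)
    (not_le.2 ((grevlex_lt_iff _ _).2 (Or.inl (not_le.1 h))))

/-- If the total degree of `p` equals its degree in `x`, then the leading coefficient of `p` has
degree `0` in `y`. -/
theorem exists_lcX_eq_C {n t : ℕ} {p : MvPolynomial (Fin n ⊕ Fin t) ℚ}
    (h : p.totalDegree = degX p) : ∃ c : ℚ, lcX p = MvPolynomial.C c := by
  refine ⟨(lcX p).coeff 0, MvPolynomial.totalDegree_eq_zero_iff_eq_C.1 (Nat.le_zero.1 ?_)⟩
  refine Finset.sup_le fun c hc => ?_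
  change c.degree ≤ 0
  rw [MvPolynomial.mem_support_iff, lcX, MonomialOrder.leadingCoeff, coeff_coeff_asPolyInX] at hc
  have h1 := MvPolynomial.le_totalDegree (MvPolynomial.mem_support_iff.2 hc)
  change (Finsupp.sumElim _ c).degree ≤ _ at h1
  have h2 : degX p ≤ _ := totalDegree_le_degree_grevlex (asPolyInX p)
  rw [degree_sumElim] at h1
  omega

/-- The only term of an element of the reduced Gröbner basis which is a leading monomial of the ideal
is its own leading monomial, to which `totalDegree_le_of_mem_of_support` applies. -/
theorem assumptionE_of_exists {n t : ℕ} {f : Fin n → MvPolynomial (Fin n ⊕ Fin t) ℚ}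
    (H : ∀ p ∈ Ideal.span (Set.range f), p ≠ 0 → ∃ h ∈ Ideal.span (Set.range f), h ≠ 0 ∧
      (elimOrder n t).degree h ≤ (elimOrder n t).degree p ∧
      h.totalDegree ≤ xDeg ((elimOrder n t).degree h)) : AssumptionE f := by
  intro g hg
  obtain ⟨hgI, hgm, hmin, hred⟩ :=
    ((isReducedGroebnerBasis_reducedGroebnerBasis _ _).mem_iff g).1 hg
  have hg0 : g ≠ 0 := hgm.ne_zero
  refine le_antisymm ?_ (degX_le_totalDegree g)
  obtain ⟨h, hI, hh0, hle, hdeg⟩ := H g hgI hg0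
  have heq : (elimOrder n t).degree h = (elimOrder n t).degree g :=
    le_antisymm hle (hmin.2 ⟨h, hI, hh0, rfl⟩ hle)
  rw [heq] at hdeg
  have hy : ((elimOrder n t).degree g).degree ≤ xDeg ((elimOrder n t).degree g) := by
    rw [← heq]
    exact (MvPolynomial.le_totalDegree ((elimOrder n t).degree_mem_support hh0)).trans
      (hdeg.trans_eq (by rw [heq]))
  refine le_trans ?_ (xDeg_le_degX ((elimOrder n t).degree_mem_support hg0))
  refine totalDegree_le_of_mem_of_support (elimOrder n t) _ (fun p hp hp0 => ?_) g hgI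
    fun c hc hcI => ?_
  · obtain ⟨h, hI, hh0, hle, hdeg⟩ := H p hp hp0
    exact ⟨h, hI, hh0, hle, hdeg.trans (xDeg_le_degree _)⟩
  · rw [hred c hc hcI]
    exact hy

/-! ### Expansion in powers of the system -/

namespace AdicExpansion

open MvPolynomial

variable {n t : ℕ} {R : Type*} [CommRing R]

/-- For an exponent vector `e` with `x`-part `a`, the product `f ^ (a / d) * x ^ (a % d)`, where the
quotient and the remainder are taken coordinatewise. -/
noncomputable def adicProduct (d : ℕ) (f : Fin n → MvPolynomial (Fin n ⊕ Fin t) R)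
    (e : Fin n ⊕ Fin t →₀ ℕ) : MvPolynomial (Fin n ⊕ Fin t) R :=
  ∏ i, f i ^ (e (Sum.inl i) / d) * X (Sum.inl i) ^ (e (Sum.inl i) % d)

/-- The `R`-linear map `x ^ a * y ^ c ↦ f ^ (a / d) * x ^ (a % d) * y ^ c`. -/
noncomputable def adicMap (d : ℕ) (f : Fin n → MvPolynomial (Fin n ⊕ Fin t) R) :
    MvPolynomial (Fin n ⊕ Fin t) R →ₗ[R] MvPolynomial (Fin n ⊕ Fin t) R :=
  (basisMonomials _ R).constr R fun e => monomial (yPart e) 1 * adicProduct d f e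

variable {d : ℕ} {f : Fin n → MvPolynomial (Fin n ⊕ Fin t) R}

theorem adicMap_monomial_one (e : Fin n ⊕ Fin t →₀ ℕ) :
    adicMap d f (monomial e 1) = monomial (yPart e) 1 * adicProduct d f e := by
  have := (basisMonomials (Fin n ⊕ Fin t) R).constr_basis R
    (fun e => monomial (yPart e) 1 * adicProduct d f e) e
  rwa [coe_basisMonomials] at this

theorem adicMap_monomial (e : Fin n ⊕ Fin t →₀ ℕ) (c : R) :
    adicMap d f (monomial e c) = monomial (yPart e) c * adicProduct d f e := by
  have h : ∀ e : Fin n ⊕ Fin t →₀ ℕ, monomial e c = c • monomial e (1 : R) := fun e => by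
    rw [smul_monomial, smul_eq_mul, mul_one]
  rw [h, map_smul, adicMap_monomial_one, h, smul_mul_assoc]

theorem adicMap_eq_sum (q : MvPolynomial (Fin n ⊕ Fin t) R) :
    adicMap d f q = ∑ e ∈ q.support, monomial (yPart e) (q.coeff e) * adicProduct d f e := by
  conv_lhs => rw [q.as_sum, map_sum]
  exact Finset.sum_congr rfl fun e _ => adicMap_monomial e _

theorem adicProduct_congr {e e' : Fin n ⊕ Fin t →₀ ℕ}
    (h : ∀ i, e (Sum.inl i) = e' (Sum.inl i)) : adicProduct d f e = adicProduct d f e' := by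
  simp [adicProduct, h]

theorem mul_adicProduct (hd : 0 < d) (i : Fin n) (e : Fin n ⊕ Fin t →₀ ℕ) :
    f i * adicProduct d f e = adicProduct d f (Finsupp.single (Sum.inl i) d + e) := by
  classical
  rw [adicProduct, adicProduct, ← Finset.mul_prod_erase _ _ (Finset.mem_univ i),
    ← Finset.mul_prod_erase _ _ (Finset.mem_univ i)]
  have h1 : ∀ j ∈ Finset.univ.erase i,
      (Finsupp.single (Sum.inl i : Fin n ⊕ Fin t) d + e) (Sum.inl j) = e (Sum.inl j) := by
    intro j hj
    have : i ≠ j := (Finset.ne_of_mem_erase hj).symm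
    simp [this]
  have h2 : (Finsupp.single (Sum.inl i : Fin n ⊕ Fin t) d + e) (Sum.inl i) =
      d + e (Sum.inl i) := by simp
  have h3 : ∏ j ∈ Finset.univ.erase i, f j ^ (e (Sum.inl j) / d) *
      X (Sum.inl j) ^ (e (Sum.inl j) % d) = ∏ j ∈ Finset.univ.erase i,
        f j ^ ((Finsupp.single (Sum.inl i : Fin n ⊕ Fin t) d + e) (Sum.inl j) / d) *
          X (Sum.inl j) ^ ((Finsupp.single (Sum.inl i : Fin n ⊕ Fin t) d + e) (Sum.inl j) % d) :=
    Finset.prod_congr rfl fun j hj => by rw [h1 j hj]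
  rw [h2, Nat.add_div_left _ hd, Nat.add_mod_left, pow_succ', h3]
  ring

theorem mul_adicMap (hd : 0 < d) (i : Fin n) (q : MvPolynomial (Fin n ⊕ Fin t) R) :
    f i * adicMap d f q = adicMap d f (monomial (Finsupp.single (Sum.inl i) d) 1 * q) := by
  induction q using MvPolynomial.induction_on' with
  | monomial e r =>
    have hy : yPart (Finsupp.single (Sum.inl i : Fin n ⊕ Fin t) d + e) = yPart e := by
      ext (j | j) <;> simp
    rw [monomial_mul, one_mul, adicMap_monomial, adicMap_monomial, hy, ← mul_adicProduct hd]
    ring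
  | add p q hp hq => rw [map_add, mul_add, hp, hq, mul_add, map_add]

theorem monomial_mul_adicMap {c : Fin n ⊕ Fin t →₀ ℕ} (hc : xPart c = 0)
    (q : MvPolynomial (Fin n ⊕ Fin t) R) :
    monomial c 1 * adicMap d f q = adicMap d f (monomial c 1 * q) := by
  induction q using MvPolynomial.induction_on' with
  | monomial e r =>
    have hy : yPart c = c := by simpa [hc] using xPart_add_yPart c
    have h0 : ∀ i, (c + e) (Sum.inl i) = e (Sum.inl i) := fun i => by
      have := congrArg (fun z => z (Sum.inl i)) hc
      simp only [xPart_inl, Finsupp.coe_zero, Pi.zero_apply] at this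
      simp [this]
    rw [monomial_mul, one_mul, adicMap_monomial, adicMap_monomial, yPart_add, hy,
      adicProduct_congr h0, ← mul_assoc, monomial_mul, one_mul]
  | add p q hp hq => rw [map_add, mul_add, hp, hq, mul_add, map_add]

/-- The polynomials of degree less than `k` in `x` and of total degree at most `D`. -/
noncomputable def lowDegree (n t : ℕ) (R : Type*) [CommRing R] (k D : ℕ) :
    Submodule R (MvPolynomial (Fin n ⊕ Fin t) R) :=
  restrictSupport R {e | xDeg e < k ∧ e.degree ≤ D}

theorem mem_lowDegree {k D : ℕ} {p : MvPolynomial (Fin n ⊕ Fin t) R} :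
    p ∈ lowDegree n t R k D ↔ ∀ e ∈ p.support, xDeg e < k ∧ e.degree ≤ D :=
  Iff.rfl

theorem lowDegree_mono {k k' D D' : ℕ} (hk : k ≤ k') (hD : D ≤ D') :
    lowDegree n t R k D ≤ lowDegree n t R k' D' :=
  restrictSupport_mono R fun _ h => ⟨h.1.trans_le hk, h.2.trans hD⟩

theorem monomial_mem_lowDegree {k D : ℕ} {e : Fin n ⊕ Fin t →₀ ℕ} (c : R) (h1 : xDeg e < k)
    (h2 : e.degree ≤ D) : monomial e c ∈ lowDegree n t R k D :=
  (monomial_mem_restrictSupport R).2 (Or.inl ⟨h1, h2⟩)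

theorem mul_mem_lowDegree {a b D D' : ℕ} {p q : MvPolynomial (Fin n ⊕ Fin t) R}
    (hp : p ∈ lowDegree n t R (a + 1) D) (hq : q ∈ lowDegree n t R b D') :
    p * q ∈ lowDegree n t R (a + b) (D + D') := by
  classical
  intro e he
  obtain ⟨u, hu, v, hv, rfl⟩ := Finset.mem_add.1 (support_mul p q he)
  have h1 := hp hu
  have h2 := hq hv
  refine ⟨?_, ?_⟩
  · rw [xDeg_add]
    have := h1.1
    have := h2.1
    omega
  · rw [map_add]
    exact add_le_add h1.2 h2.2

theorem mem_lowDegree_of_totalDegree_le {D : ℕ} {p : MvPolynomial (Fin n ⊕ Fin t) R}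
    (h : p.totalDegree ≤ D) : p ∈ lowDegree n t R (D + 1) D := by
  intro e he
  have h1 : e.degree ≤ D := (le_totalDegree he).trans h
  exact ⟨Nat.lt_succ_of_le ((xDeg_le_degree e).trans h1), h1⟩

theorem totalDegree_adicProduct_le (hf : ∀ i, (f i).totalDegree ≤ d) (e : Fin n ⊕ Fin t →₀ ℕ) :
    (adicProduct d f e).totalDegree ≤ xDeg e := by
  rw [xDeg_eq_sum]
  refine (totalDegree_finsetProd _ _).trans (Finset.sum_le_sum fun i _ => ?_)
  refine (totalDegree_mul _ _).trans ?_
  calc _ ≤ e (Sum.inl i) / d * d + e (Sum.inl i) % d := by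
        refine add_le_add ((totalDegree_pow _ _).trans (Nat.mul_le_mul_left _ (hf i))) ?_
        rw [X_pow_eq_monomial]
        refine (totalDegree_monomial_le _ _).trans ?_
        simp
    _ = _ := Nat.div_add_mod' _ _

theorem adicMap_mem_lowDegree (hf : ∀ i, (f i).totalDegree ≤ d) {k D : ℕ}
    {q : MvPolynomial (Fin n ⊕ Fin t) R} (hq : q ∈ lowDegree n t R k D) :
    adicMap d f q ∈ lowDegree n t R k D := by
  rw [adicMap_eq_sum]
  refine Submodule.sum_mem _ fun e he => ?_
  obtain ⟨h1, h2⟩ := hq he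
  have hy : monomial (yPart e) (q.coeff e) ∈ lowDegree n t R (0 + 1) (yPart e).degree :=
    monomial_mem_lowDegree _ (by simp [xDeg]) le_rfl
  have h3 := mul_mem_lowDegree hy
    (mem_lowDegree_of_totalDegree_le (totalDegree_adicProduct_le hf e))
  rw [degree_eq] at h2
  exact lowDegree_mono (by omega) (by omega) h3

/-- The polynomials in `x` that are homogeneous of degree `k`. -/
noncomputable def pureX (n t : ℕ) (R : Type*) [CommRing R] (k : ℕ) :
    Submodule R (MvPolynomial (Fin n ⊕ Fin t) R) :=
  restrictSupport R {e | yPart e = 0 ∧ e.degree = k}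

/-- The images under `adicMap d f` of the homogeneous polynomials in `x` exhaust, modulo smaller
degrees in `x`, the monomials in `x` of degree at most `n * (d - 1) + 1`. In terms of the parts
`fᵢ*` of degree `d` of `fᵢ(x, 0)`: the products `(f*) ^ (a / d) * x ^ (a % d)` with `|a| = k` span
the homogeneous polynomials of degree `k`. -/
def SpansTopDegrees (d : ℕ) (f : Fin n → MvPolynomial (Fin n ⊕ Fin t) R) : Prop :=
  ∀ k ≤ n * (d - 1) + 1, ∀ e : Fin n ⊕ Fin t →₀ ℕ, yPart e = 0 → e.degree = k →
    ∃ q ∈ pureX n t R k, monomial e 1 - adicMap d f q ∈ lowDegree n t R k k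

/-- The map `adicMap d f` is surjective on each `lowDegree n t R k D`. Up to degree
`n * (d - 1) + 1` in `x` this is the hypothesis. In that degree each exponent vector has a
coordinate which is at least `d`, so that the monomials are, modulo smaller degrees in `x`,
combinations of the `fᵢ`; this permits an induction for the larger degrees. -/
theorem lowDegree_le_map (hd : 0 < d) (hf : ∀ i, (f i).totalDegree ≤ d)
    (H : SpansTopDegrees d f) (k : ℕ) :
    ∀ D, lowDegree n t R k D ≤ (lowDegree n t R k D).map (adicMap d f) := by
  induction k using Nat.strong_induction_on with
  | _ k ih =>
  intro D
  obtain _ | k := k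
  · intro p hp
    have : p = 0 := by
      rw [← support_eq_empty, Finset.eq_empty_iff_forall_notMem]
      exact fun e he => absurd (hp he).1 (Nat.not_lt_zero _)
    rw [this]
    exact zero_mem _
  have hstep : ∀ p ∈ lowDegree n t R k D, p ∈ (lowDegree n t R (k + 1) D).map (adicMap d f) :=
    fun p hp => Submodule.map_mono (lowDegree_mono (Nat.le_succ k) le_rfl)
      (ih k (Nat.lt_succ_self k) D hp)
  conv_lhs => rw [lowDegree, restrictSupport_eq_span]
  rw [Submodule.span_le]
  rintro _ ⟨e, ⟨hek, heD⟩, rfl⟩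
  change monomial e 1 ∈ (lowDegree n t R (k + 1) D).map (adicMap d f)
  rcases (Nat.lt_succ_iff.1 hek).lt_or_eq with hlt | rfl
  · exact hstep _ (monomial_mem_lowDegree _ hlt heD)
  rw [degree_eq] at heD
  by_cases hk : xDeg e ≤ n * (d - 1) + 1
  · obtain ⟨q, hq, hr⟩ := H _ hk (xPart e) (yPart_xPart e) rfl
    have hqL : q ∈ lowDegree n t R (xDeg e + 1) (xDeg e) := fun u hu =>
      ⟨Nat.lt_succ_of_le ((xDeg_le_degree u).trans (hq hu).2.le), (hq hu).2.le⟩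
    have hy : monomial (yPart e) (1 : R) ∈ lowDegree n t R (0 + 1) (yPart e).degree :=
      monomial_mem_lowDegree _ (by simp [xDeg]) le_rfl
    have he : monomial e (1 : R) = adicMap d f (monomial (yPart e) 1 * q) +
        monomial (yPart e) 1 * (monomial (xPart e) 1 - adicMap d f q) := by
      rw [← monomial_mul_adicMap (xPart_yPart e), mul_sub, monomial_mul, one_mul, add_comm (yPart e),
        xPart_add_yPart]
      ring
    rw [he]
    refine add_mem (Submodule.mem_map_of_mem ?_) (hstep _ ?_)
    · exact lowDegree_mono (by omega) (by omega) (mul_mem_lowDegree hy hqL)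
    · exact lowDegree_mono (by omega) (by omega) (mul_mem_lowDegree hy hr)
  · obtain ⟨e', hle, he'⟩ := Finsupp.exists_le_degree_eq (xPart e) (n * (d - 1) + 1)
      (by rw [← xDeg]; omega)
    have hye' : yPart e' = 0 := by
      ext (i | j)
      · simp
      · simpa using hle (Sum.inr j)
    obtain ⟨e'', hsum⟩ := exists_add_of_le hle
    have hee : e = (e'' + yPart e) + e' := by
      conv_lhs => rw [← xPart_add_yPart e, hsum]
      abel
    have hdx : xDeg e = xDeg (e'' + yPart e) + (n * (d - 1) + 1) := by
      rw [← he', ← xDeg_eq_degree hye', ← xDeg_add, ← hee]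
    have hdd : e.degree = (e'' + yPart e).degree + (n * (d - 1) + 1) := by
      rw [← he', ← map_add, ← hee]
    rw [degree_eq] at hdd
    obtain ⟨q, hq, hr⟩ := H _ le_rfl e' hye' he'
    have hu : ∀ c : R, monomial (e'' + yPart e) c ∈
        lowDegree n t R (xDeg (e'' + yPart e) + 1) (e'' + yPart e).degree :=
      fun c => monomial_mem_lowDegree c (Nat.lt_succ_self _) le_rfl
    generalize e'' + yPart e = u at *
    have he : monomial e (1 : R) = monomial u 1 * adicMap d f q +
        monomial u 1 * (monomial e' 1 - adicMap d f q) := by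
      rw [mul_sub, monomial_mul, one_mul, ← hee]
      ring
    rw [he]
    refine add_mem ?_ (hstep _ (lowDegree_mono (by omega) (by omega) (mul_mem_lowDegree (hu 1) hr)))
    rw [adicMap_eq_sum, Finset.mul_sum]
    refine Submodule.sum_mem _ fun a ha => ?_
    obtain ⟨hay, had⟩ := hq ha
    -- As `∑ aᵢ > n * (d - 1)`, some `aᵢ` is at least `d`.
    obtain ⟨i, hi⟩ : ∃ i, d ≤ a (Sum.inl i) := by
      by_contra! hcon
      rw [← xDeg_eq_degree hay, xDeg_eq_sum] at had
      have : ∑ i, a (Sum.inl i) ≤ ∑ _i : Fin n, (d - 1) :=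
        Finset.sum_le_sum fun i _ => Nat.le_sub_one_of_lt (hcon i)
      simp at this
      omega
    obtain ⟨b, rfl⟩ : ∃ b, a = Finsupp.single (Sum.inl i) d + b :=
      exists_add_of_le (Finsupp.single_le_iff.2 hi)
    have hbd : d + b.degree = n * (d - 1) + 1 := by
      rw [← had, map_add, Finsupp.degree_single]
    have hbx := xDeg_le_degree b
    rw [← mul_adicProduct hd, hay]
    have hw : monomial u (1 : R) * (monomial 0 (q.coeff (Finsupp.single (Sum.inl i) d + b)) *
        adicProduct d f b) ∈ lowDegree n t R (xDeg e - d + 1) (D - d) := by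
      have h1 := mul_mem_lowDegree (hu (q.coeff (Finsupp.single (Sum.inl i) d + b)))
        (mem_lowDegree_of_totalDegree_le (totalDegree_adicProduct_le hf b))
      rw [← mul_assoc, monomial_mul, one_mul, add_zero]
      exact lowDegree_mono (by omega) (by omega) h1
    obtain ⟨w, hwL, hwe⟩ := ih (xDeg e - d + 1) (by omega) _ hw
    refine ⟨monomial (Finsupp.single (Sum.inl i) d) 1 * w, ?_, ?_⟩
    · have hX : monomial (Finsupp.single (Sum.inl i : Fin n ⊕ Fin t) d) (1 : R) ∈
          lowDegree n t R (d + 1) d := by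
        have : (Finsupp.single (Sum.inl i : Fin n ⊕ Fin t) d).degree = d :=
          Finsupp.degree_single _ _
        exact monomial_mem_lowDegree _
          (Nat.lt_succ_of_le ((xDeg_le_degree _).trans this.le)) this.le
      exact lowDegree_mono (by omega) (by omega) (mul_mem_lowDegree hX hwL)
    · rw [← mul_adicMap hd, hwe]
      ring

end AdicExpansion

/-! ### Leading monomials of the ideal of the system -/

namespace AdicExpansion

open MvPolynomial

variable {n t d : ℕ} {K : Type*} [Field K] {f : Fin n → MvPolynomial (Fin n ⊕ Fin t) K}

/-- A surjective endomorphism of the finite-dimensional space `lowDegree n t K k D` is injective. -/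
theorem adicMap_injective (hd : 0 < d) (hf : ∀ i, (f i).totalDegree ≤ d)
    (H : SpansTopDegrees d f) : Function.Injective (adicMap d f) := by
  rw [injective_iff_map_eq_zero]
  intro q hq
  set L := lowDegree n t K (q.totalDegree + 1) q.totalDegree with hL
  have hqL : q ∈ L := mem_lowDegree_of_totalDegree_le le_rfl
  have hfin : {e : Fin n ⊕ Fin t →₀ ℕ | xDeg e < q.totalDegree + 1 ∧
      e.degree ≤ q.totalDegree}.Finite :=
    (Finsupp.finite_of_degree_le q.totalDegree).subset fun e he => he.2
  have := hfin.to_subtype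
  have : FiniteDimensional K L := Module.Finite.of_basis (basisRestrictSupport K _)
  let φ : L →ₗ[K] L := (adicMap d f).restrict fun p hp => adicMap_mem_lowDegree hf hp
  have hsurj : Function.Surjective φ := by
    rintro ⟨p, hp⟩
    obtain ⟨w, hw, rfl⟩ := lowDegree_le_map hd hf H _ _ hp
    exact ⟨⟨w, hw⟩, rfl⟩
  have hinj : Function.Injective φ := LinearMap.injective_iff_surjective.2 hsurj
  have : (⟨q, hqL⟩ : L) = 0 := hinj (Subtype.ext (by simpa [φ] using hq))
  exact congrArg Subtype.val this

/-- Every element of `⟨f₁, …, fₙ⟩` is the image of an element of the monomial ideal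
`⟨x₁ ^ d, …, xₙ ^ d⟩`. -/
theorem exists_adicMap_eq_of_mem_span (hd : 0 < d) (hf : ∀ i, (f i).totalDegree ≤ d)
    (H : SpansTopDegrees d f) {p : MvPolynomial (Fin n ⊕ Fin t) K}
    (hp : p ∈ Ideal.span (Set.range f)) :
    ∃ q : MvPolynomial (Fin n ⊕ Fin t) K, (∀ e ∈ q.support, ∃ i, d ≤ e (Sum.inl i)) ∧
      adicMap d f q = p := by
  classical
  have hsurj : ∀ p, ∃ q, adicMap d f q = p := fun p => by
    obtain ⟨q, -, hq⟩ := lowDegree_le_map hd hf H _ _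
      (mem_lowDegree_of_totalDegree_le (le_refl p.totalDegree))
    exact ⟨q, hq⟩
  obtain ⟨c, rfl⟩ := Ideal.mem_span_range_iff_exists_fun.1 hp
  choose w hw using fun i => hsurj (c i)
  refine ⟨∑ i, monomial (Finsupp.single (Sum.inl i) d) 1 * w i, fun e he => ?_, ?_⟩
  · obtain ⟨i, -, hi⟩ := Finset.mem_biUnion.1 (support_sum he)
    refine ⟨i, ?_⟩
    rw [mem_support_iff, coeff_monomial_mul'] at hi
    by_contra hlt
    rw [if_neg fun h => hlt (Finsupp.single_le_iff.1 h)] at hi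
    exact hi rfl
  · rw [map_sum]
    refine Finset.sum_congr rfl fun i _ => ?_
    rw [← mul_adicMap hd, hw, mul_comm]

theorem adicProduct_mem_span (hd : 0 < d) {e : Fin n ⊕ Fin t →₀ ℕ}
    (he : ∃ i, d ≤ e (Sum.inl i)) : adicProduct d f e ∈ Ideal.span (Set.range f) := by
  obtain ⟨i, hi⟩ := he
  obtain ⟨b, rfl⟩ : ∃ b, e = Finsupp.single (Sum.inl i) d + b :=
    exists_add_of_le (Finsupp.single_le_iff.2 hi)
  rw [← mul_adicProduct hd]
  exact Ideal.mul_mem_right _ _ (Ideal.subset_span ⟨i, rfl⟩)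

/-- Let `q` have degree at most `k` in `x`. The coefficient of `adicMap d f q` at a monomial of
degree `k` in `x` involves only the terms of `q` of degree `k` in `x` with the same `y`-part. -/
theorem coeff_adicMap (hf : ∀ i, (f i).totalDegree ≤ d) {k : ℕ}
    {q : MvPolynomial (Fin n ⊕ Fin t) K} (hq : ∀ e ∈ q.support, xDeg e ≤ k)
    {a b : Fin n ⊕ Fin t →₀ ℕ} (ha : yPart a = 0) (hak : a.degree = k) (hb : xPart b = 0) :
    (adicMap d f q).coeff (a + b) =
      ∑ e ∈ q.support with xDeg e = k ∧ yPart e = b, q.coeff e * (adicProduct d f e).coeff a := by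
  classical
  have hyb : yPart b = b := by simpa [hb] using xPart_add_yPart b
  rw [adicMap_eq_sum, coeff_sum, Finset.sum_filter]
  refine Finset.sum_congr rfl fun e he => ?_
  split_ifs with hc
  · rw [hc.2, add_comm a b, coeff_monomial_mul]
  · rw [coeff_monomial_mul']
    split_ifs with hle
    · suffices h : (adicProduct d f e).coeff (a + b - yPart e) = 0 by rw [h, mul_zero]
      by_contra hne
      apply hc
      have hadd : a + b - yPart e + yPart e = a + b := tsub_add_cancel_of_le hle
      have hdeg : (a + b - yPart e).degree ≤ xDeg e :=
        (le_totalDegree (mem_support_iff.2 hne)).trans (totalDegree_adicProduct_le hf e)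
      generalize a + b - yPart e = u at *
      have hx : xDeg u = k := by
        have := congrArg xDeg hadd
        rw [xDeg_add, xDeg_add, xDeg_eq_degree ha, hak] at this
        simpa [xDeg, hb] using this
      have hek : xDeg e = k := le_antisymm (hq e he) (hx ▸ (xDeg_le_degree u).trans hdeg)
      have hu : yPart u = 0 := yPart_eq_zero_of_degree_le (by omega)
      refine ⟨hek, ?_⟩
      have := congrArg yPart hadd
      simpa [hu, ha, hyb] using this
    · rfl

/-- The `x`-part of each leading monomial of `⟨f₁, …, fₙ⟩` is the leading monomial of an element of
total degree at most the degree of this `x`-part. Namely, write `p = adicMap d f q`, where `q` has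
the same degree in `x` as `p`, and keep the terms of `q` that contribute to the coefficient of `p`
at the leading monomial. -/
theorem exists_mem_span_totalDegree_le (hd : 0 < d) (hf : ∀ i, (f i).totalDegree ≤ d)
    (H : SpansTopDegrees d f) {p : MvPolynomial (Fin n ⊕ Fin t) K}
    (hp : p ∈ Ideal.span (Set.range f)) (hp0 : p ≠ 0) :
    ∃ h ∈ Ideal.span (Set.range f), h ≠ 0 ∧
      (elimOrder n t).degree h ≤ (elimOrder n t).degree p ∧
      h.totalDegree ≤ xDeg ((elimOrder n t).degree h) := by
  classical
  set m := elimOrder n t with hm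
  set e₀ := m.degree p with he₀
  have hpL : p ∈ lowDegree n t K (xDeg e₀ + 1) p.totalDegree := fun c hc =>
    ⟨Nat.lt_succ_of_le (xDeg_le_of_le (m.le_degree hc)), le_totalDegree hc⟩
  obtain ⟨q, hqL, hqp⟩ := lowDegree_le_map hd hf H _ _ hpL
  have hqI : ∀ e ∈ q.support, ∃ i, d ≤ e (Sum.inl i) := by
    obtain ⟨q', hq', hqp'⟩ := exists_adicMap_eq_of_mem_span hd hf H hp
    rwa [adicMap_injective hd hf H (hqp.trans hqp'.symm)]
  have hqx : ∀ e ∈ q.support, xDeg e ≤ xDeg e₀ := fun e he => Nat.lt_succ_iff.1 (hqL he).1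
  set h := ∑ e ∈ q.support with xDeg e = xDeg e₀ ∧ yPart e = yPart e₀,
    C (q.coeff e) * adicProduct d f e with hh
  have hcoeff : ∀ a, yPart a = 0 → a.degree = xDeg e₀ →
      h.coeff a = p.coeff (a + yPart e₀) := by
    intro a ha hak
    rw [← hqp, coeff_adicMap hf hqx ha hak (xPart_yPart e₀), hh, coeff_sum]
    exact Finset.sum_congr rfl fun e _ => coeff_C_mul _ _ _
  have hxd : xDeg (xPart e₀) = xDeg e₀ := by simp [xDeg]
  have hlead : h.coeff (xPart e₀) ≠ 0 := by
    rw [hcoeff _ (yPart_xPart e₀) rfl, xPart_add_yPart]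
    exact m.coeff_degree_ne_zero_iff.2 hp0
  have htot : h.totalDegree ≤ xDeg e₀ := by
    refine totalDegree_finsetSum_le fun e he => (totalDegree_mul _ _).trans ?_
    rw [totalDegree_C, zero_add, ← (Finset.mem_filter.1 he).2.1]
    exact totalDegree_adicProduct_le hf e
  have hdeg : m.degree h = xPart e₀ := by
    apply m.toSyn.injective
    refine le_antisymm (m.degree_le_iff.2 fun c hc => ?_)
      (m.le_degree (mem_support_iff.2 hlead))
    have hcd : c.degree ≤ xDeg e₀ := (le_totalDegree hc).trans htot
    rcases ((xDeg_le_degree c).trans hcd).lt_or_eq with hlt | heq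
    · exact (lt_of_xDeg_lt (hlt.trans_eq hxd.symm)).le
    · have hyc : yPart c = 0 := yPart_eq_zero_of_degree_le (by omega)
      rw [mem_support_iff, hcoeff c hyc (by rw [← xDeg_eq_degree hyc, heq])] at hc
      have := m.le_degree (mem_support_iff.2 hc)
      rw [← he₀, ← xPart_add_yPart e₀, map_add, map_add, yPart_add, yPart_xPart, yPart_yPart,
        zero_add] at this
      exact le_of_add_le_add_right this
  refine ⟨h, ?_, fun h0 => hlead (by rw [h0, coeff_zero]), ?_, ?_⟩
  · exact Ideal.sum_mem _ fun e he =>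
      Ideal.mul_mem_left _ _ (adicProduct_mem_span hd (hqI e (Finset.mem_filter.1 he).1))
  · rw [hdeg]
    conv_rhs => rw [← xPart_add_yPart e₀]
    exact le_self_add
  · rwa [hdeg, hxd]

end AdicExpansion

/-! ### The discriminant and its non-vanishing -/

namespace AdicExpansion

open MvPolynomial

variable {n t : ℕ} {R : Type*} [CommRing R]

/-- The exponent vectors of the monomials in `x` of degree `k`. -/
abbrev PureExponent (n t k : ℕ) : Type :=
  {e : Fin n ⊕ Fin t →₀ ℕ // yPart e = 0 ∧ e.degree = k}

noncomputable instance (k : ℕ) : Fintype (PureExponent n t k) :=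
  ((Finsupp.finite_of_degree_eq k).subset fun _ h => h.2 :
    {e : Fin n ⊕ Fin t →₀ ℕ | yPart e = 0 ∧ e.degree = k}.Finite).fintype

noncomputable instance (σ : Type*) [Finite σ] (d : ℕ) : Fintype {e : σ →₀ ℕ // e.degree ≤ d} :=
  (Finsupp.finite_of_degree_le d).fintype

/-- The square matrix of the coefficients of the products `f ^ (a / d) * x ^ (a % d)` with `|a| = k`
at the monomials in `x` of degree `k`. -/
noncomputable def adicMatrix (d : ℕ) (f : Fin n → MvPolynomial (Fin n ⊕ Fin t) R) (k : ℕ) :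
    Matrix (PureExponent n t k) (PureExponent n t k) R :=
  Matrix.of fun a b => (adicProduct d f b).coeff a

theorem adicMatrix_map {S : Type*} [CommRing S] (φ : R →+* S) (d : ℕ)
    (f : Fin n → MvPolynomial (Fin n ⊕ Fin t) R) (k : ℕ) :
    adicMatrix d (fun i => map φ (f i)) k = φ.mapMatrix (adicMatrix d f k) := by
  ext a b
  rw [RingHom.mapMatrix_apply, Matrix.map_apply, adicMatrix, adicMatrix, Matrix.of_apply,
    Matrix.of_apply, ← coeff_map]
  congr 1
  simp [adicProduct]

theorem adicMatrix_X_pow (d k : ℕ) :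
    adicMatrix d (fun i => (X (Sum.inl i) ^ d : MvPolynomial (Fin n ⊕ Fin t) R)) k = 1 := by
  classical
  ext a b
  have h : adicProduct d (fun i => (X (Sum.inl i) ^ d : MvPolynomial (Fin n ⊕ Fin t) R)) b =
      monomial b.1 1 := by
    rw [monomial_eq, C_1, one_mul, Finsupp.prod_fintype _ _ fun _ => pow_zero _,
      Fintype.prod_sum_type]
    have h1 : ∀ j, b.1 (Sum.inr j) = 0 := fun j => by
      rw [← yPart_inr, b.2.1]
      rfl
    simp only [h1, pow_zero, Finset.prod_const_one, mul_one, adicProduct]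
    refine Finset.prod_congr rfl fun i _ => ?_
    rw [← pow_mul, ← pow_add, Nat.div_add_mod]
  rw [adicMatrix, Matrix.of_apply, h, coeff_monomial, Matrix.one_apply]
  simp only [Subtype.ext_iff, eq_comm]

theorem spansTopDegrees_of_det_ne_zero {K : Type*} [Field K] {d : ℕ}
    {f : Fin n → MvPolynomial (Fin n ⊕ Fin t) K} (hf : ∀ i, (f i).totalDegree ≤ d)
    (H : ∀ k ≤ n * (d - 1) + 1, (adicMatrix d f k).det ≠ 0) : SpansTopDegrees d f := by
  classical
  intro k hk e hey hek
  let M := adicMatrix d f k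
  obtain ⟨v, hv⟩ : ∃ v, M.mulVec v = Pi.single ⟨e, hey, hek⟩ 1 :=
    ⟨M⁻¹.mulVec (Pi.single ⟨e, hey, hek⟩ 1), by
      rw [Matrix.mulVec_mulVec, Matrix.mul_nonsing_inv _ (isUnit_iff_ne_zero.2 (H k hk)),
        Matrix.one_mulVec]⟩
  refine ⟨∑ b : PureExponent n t k, monomial b.1 (v b), Submodule.sum_mem _ fun b _ =>
    (monomial_mem_restrictSupport K).2 (Or.inl b.2), ?_⟩
  have hΦ : adicMap d f (∑ b : PureExponent n t k, monomial b.1 (v b)) =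
      ∑ b : PureExponent n t k, C (v b) * adicProduct d f b := by
    rw [map_sum]
    refine Finset.sum_congr rfl fun b _ => ?_
    rw [adicMap_monomial, b.2.1]
    rfl
  rw [hΦ]
  have htot : (monomial e 1 - ∑ b : PureExponent n t k, C (v b) * adicProduct d f b).totalDegree
      ≤ k := by
    refine (totalDegree_sub _ _).trans (max_le ?_ ?_)
    · exact (totalDegree_monomial_le _ _).trans hek.le
    · refine totalDegree_finsetSum_le fun b _ => (totalDegree_mul _ _).trans ?_
      rw [totalDegree_C, zero_add]
      refine (totalDegree_adicProduct_le hf _).trans ?_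
      rw [xDeg_eq_degree b.2.1, b.2.2]
  rw [mem_lowDegree]
  intro c hc
  have hcd : c.degree ≤ k := (le_totalDegree hc).trans htot
  refine ⟨((xDeg_le_degree c).trans hcd).lt_of_ne fun heq => ?_, hcd⟩
  have hyc : yPart c = 0 := yPart_eq_zero_of_degree_le (by omega)
  have hck : c.degree = k := by rw [← xDeg_eq_degree hyc, heq]
  refine mem_support_iff.1 hc ?_
  have h1 := congrFun hv ⟨c, hyc, hck⟩
  rw [coeff_sub, coeff_monomial, coeff_sum, sub_eq_zero]
  simp only [coeff_C_mul]
  rw [Matrix.mulVec, dotProduct] at h1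
  simp only [M, adicMatrix, Matrix.of_apply, Pi.single_apply, Subtype.mk.injEq] at h1
  simp only [mul_comm (v _)]
  rw [h1]
  simp only [eq_comm]

/-- The system of `n` polynomials of degree `d` whose coefficients are independent variables. -/
noncomputable def genericSystem (n t d : ℕ) (i : Fin n) : MvPolynomial (Fin n ⊕ Fin t)
    (MvPolynomial (Fin n × {e : (Fin n ⊕ Fin t) →₀ ℕ // e.degree ≤ d}) ℂ) :=
  ∑ e : {e : (Fin n ⊕ Fin t) →₀ ℕ // e.degree ≤ d}, monomial e.1 (X (i, e))

theorem map_eval_genericSystem {n t d : ℕ} (F : SystemSpace n t d) (i : Fin n) :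
    map (eval F.coords) (genericSystem n t d i) = F i := by
  classical
  ext c
  rw [genericSystem, map_sum, coeff_sum]
  simp only [map_monomial, eval_X, coeff_monomial]
  by_cases hc : c.degree ≤ d
  · rw [Finset.sum_eq_single ⟨c, hc⟩]
    · simp [SystemSpace.coords]
    · intro b _ hb
      exact if_neg fun h => hb (Subtype.ext h)
    · simp
  · rw [Finset.sum_eq_zero fun b _ => if_neg fun h : b.1 = c => hc (h ▸ b.2)]
    by_contra hne
    exact hc ((mem_restrictTotalDegree _ _ _ |>.1 (F i).2).trans' (le_totalDegree
      (mem_support_iff.2 (Ne.symm hne))))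

/-- The product of the determinants of the matrices `adicMatrix d f k` for `k ≤ n * (d - 1) + 1`, as
a polynomial in the coefficients of `f`. -/
noncomputable def adicDiscriminant (n t d : ℕ) :
    MvPolynomial (Fin n × {e : (Fin n ⊕ Fin t) →₀ ℕ // e.degree ≤ d}) ℂ :=
  ∏ k ∈ Finset.range (n * (d - 1) + 2), (adicMatrix d (genericSystem n t d) k).det

theorem eval_adicDiscriminant {n t d : ℕ} (F : SystemSpace n t d) :
    eval F.coords (adicDiscriminant n t d) = ∏ k ∈ Finset.range (n * (d - 1) + 2),
      (adicMatrix d (fun i => (F i : MvPolynomial (Fin n ⊕ Fin t) ℂ)) k).det := by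
  rw [adicDiscriminant, map_prod]
  refine Finset.prod_congr rfl fun k _ => ?_
  rw [RingHom.map_det, ← adicMatrix_map]
  simp only [map_eval_genericSystem]

theorem totalDegree_le_of_map_eq {n t d : ℕ} {F : SystemSpace n t d}
    {f : Fin n → MvPolynomial (Fin n ⊕ Fin t) ℚ}
    (hF : ∀ i, (F i : MvPolynomial (Fin n ⊕ Fin t) ℂ) = map (algebraMap ℚ ℂ) (f i)) (i : Fin n) :
    (f i).totalDegree ≤ d := by
  have h := (mem_restrictTotalDegree _ _ _).1 (F i).2
  rw [hF] at h
  rwa [totalDegree, support_map_of_injective _ (algebraMap ℚ ℂ).injective] at h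

end AdicExpansion

open AdicExpansion

theorem mainTheorem9 (n t d : ℕ) :
    ∃ U : Set (SystemSpace n t d), SystemSpace.IsZariskiOpen U ∧ U.Nonempty ∧
      ∀ f : Fin n → MvPolynomial (Fin n ⊕ Fin t) ℚ,
        (∃ F ∈ U, ∀ i, (F i : MvPolynomial (Fin n ⊕ Fin t) ℂ) =
          MvPolynomial.map (algebraMap ℚ ℂ) (f i)) →
        AssumptionE f ∧ AssumptionC f := by
  suffices h : ∃ P : MvPolynomial (Fin n × {e : (Fin n ⊕ Fin t) →₀ ℕ // e.degree ≤ d}) ℂ,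
      (∃ F : SystemSpace n t d, MvPolynomial.eval F.coords P ≠ 0) ∧
      ∀ (f : Fin n → MvPolynomial (Fin n ⊕ Fin t) ℚ) (F : SystemSpace n t d),
        (∀ i, (F i : MvPolynomial (Fin n ⊕ Fin t) ℂ) = MvPolynomial.map (algebraMap ℚ ℂ) (f i)) →
        MvPolynomial.eval F.coords P ≠ 0 → AssumptionE f by
    obtain ⟨P, ⟨F₀, hF₀⟩, hP⟩ := h
    refine ⟨{F | ∃ Q ∈ ({P} : Set _), MvPolynomial.eval F.coords Q ≠ 0}, ⟨{P}, rfl⟩,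
      ⟨F₀, P, rfl, hF₀⟩, ?_⟩
    rintro f ⟨F, ⟨_, rfl, hF⟩, hf⟩
    have hE := hP f F hf hF
    exact ⟨hE, fun g hg => exists_lcX_eq_C (hE g hg)⟩
  obtain rfl | hd := Nat.eq_zero_or_pos d
  · -- The members of the system are constants; the open set is that of nonzero constants.
    refine ⟨∏ i, MvPolynomial.X (i, ⟨0, by simp⟩),
      ⟨fun _ => ⟨1, by simp [MvPolynomial.mem_restrictTotalDegree]⟩, ?_⟩, fun f F hF hne => ?_⟩
    · simp [SystemSpace.coords]
    · refine assumptionE_of_exists fun p hp hp0 => ?_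
      obtain ⟨i⟩ : Nonempty (Fin n) := by
        by_contra hcon
        rw [not_nonempty_iff] at hcon
        rw [Set.range_eq_empty, Ideal.span_empty] at hp
        exact hp0 hp
      have hc : (f i).coeff 0 ≠ 0 := by
        rw [map_prod, Finset.prod_ne_zero_iff] at hne
        have := hne i (Finset.mem_univ i)
        rw [MvPolynomial.eval_X, SystemSpace.coords, hF, MvPolynomial.coeff_map] at this
        exact fun h0 => this (by rw [h0, map_zero])
      refine ⟨f i, Ideal.subset_span ⟨i, rfl⟩, fun h0 => hc (by simp [h0]), ?_, ?_⟩
      · rw [(elimOrder n t).degree_eq_zero_iff_totalDegree_eq_zero.2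
          (Nat.le_zero.1 (totalDegree_le_of_map_eq hF i))]
        exact zero_le
      · exact (totalDegree_le_of_map_eq hF i).trans (Nat.zero_le _)
  · refine ⟨adicDiscriminant n t d, ⟨fun i => ⟨MvPolynomial.X (Sum.inl i) ^ d, ?_⟩, ?_⟩,
      fun f F hF hne => ?_⟩
    · rw [MvPolynomial.mem_restrictTotalDegree, MvPolynomial.totalDegree_X_pow]
    · rw [eval_adicDiscriminant]
      simp [adicMatrix_X_pow]
    · have hf := totalDegree_le_of_map_eq hF
      refine assumptionE_of_exists fun p hp hp0 =>
        exists_mem_span_totalDegree_le hd hf (spansTopDegrees_of_det_ne_zero hf fun k hk h0 => ?_)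
          hp hp0
      rw [eval_adicDiscriminant, Finset.prod_ne_zero_iff] at hne
      refine hne k (Finset.mem_range.2 (by omega)) ?_
      simp only [hF]
      rw [adicMatrix_map, ← RingHom.map_det, h0, map_zero]
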